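/- Let $X$ be a $0$-dimensional compact Hausdorff space, that is, a compact Hausdorff space with a basis of clopen sets. A partial homeomorphism of $X$ is a homeomorphism between two open subsets of $X$. Let $(m_n)_{n\ge 0}$ be positive integers with $m_0=1$; for each $n\ge 0$ let $B(r,n)$, $1\le r\le m_n$, be pairwise disjoint clopen subsets of $X$, with $B(1,0)=X$, and put $U_n=\bigcup_{r=1}^{m_n}B(r,n)$. Let $\kappa(r,n)$ be positive integers with $\kappa(1,0)=1$ and, for $n\ge 0$, $1\le r\le m_n$, $1\le s\le\kappa(r,n)$, let $\sigma^{(n)}_{r,s}$ be a partial homeomorphism of $X$ with domain $B(r,n)$, where $\sigma^{(0)}_{1,1}=\mathrm{id}_X$. Suppose that for every $n\ge 1$: (i) $\sigma^{(n)}_{r,1}(x)=x$ for all $1\le r\le m_n$ and $x\in B(r,n)$; (ii) for all $r,s$ there is $1\le i\le m_{n-1}$ with $\sigma^{(n)}_{r,s}(B(r,n))\subset B(i,n-1)$; (iii) the sets $\sigma^{(n)}_{r,s}(B(r,n))$, $1\le r\le m_n$, $1\le s\le\kappa(r,n)$, are pairwise disjoint and their union is $U_{n-1}$. (In particular $X=U_0\supset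 U_1\supset U_2\supset\cdots$.) Let $S$ be the inverse semigroup generated by the maps $\sigma^{(n)}_{r,s}$: the smallest set of partial homeomorphisms that contains all restrictions of the $\sigma^{(n)}_{r,s}$ to clopen subsets of their domains and is closed under inverses and compositions. Let $\mathcal R\subset X\times X$ be the union of the graphs of the elements of $S$, with the topology generated by the graphs of the restrictions of elements of $S$ to clopen sets. Then $\mathcal R$ is an equivalence relation on $X$ and, with $(x,y)(y,z)=(x,z)$ and $(x,y)^{-1}=(y,x)$, an $r$-discrete locally compact Hausdorff groupoid (the range map $(x,y)\mapsto x$ is a local homeomorphism, and $x\mapsto(x,x)$ is a homeomorphism of $X$ onto an open subset of $\mathcal R$). Its groupoid C*-algebra $C^*(\mathcal R)$, the completion of the convolution $*$-algebra $C_c(\mathcal R)$ in the norm $\|f\|=\sup_\pi\|\pi(f)\|$ over all $*$-representations $\pi$ on Hilbert spaces that are bounded by the $I$-norm $\|f\|_I=\max\bigl(\sup_x\sum_y|f(x,y)|,\ \sup_y\sum_x|f(x,y)|\bigr)$, is the closure of the union of an upward directed family of finite-dimensional C*-subalgebras. If moreover $X$ has a countable base, then $\mathcal R$ is an AF groupoid: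 $C^*(\mathcal R)$ is an AF algebra, that is, the closure of the union of an increasing sequence of finite-dimensional C*-subalgebras. -/

import Mathlib

open scoped ENNReal CompactlySupported

universe u

noncomputable section

/-! ### Equivalence relations as topological groupoids -/

/-- A relation on `X` whose graph, a subset of `X × X`, carries a topology of its own (in general
finer than the one inherited from `X × X`). If the relation is an equivalence relation, its graph is
a groupoid with unit space `X` for the operations `(x, y)(y, z) = (x, z)` and
`(x, y)⁻¹ = (y, x)`. -/
structure TopRel (X : Type u) where
  rel : X → X → Prop
  top : TopologicalSpace {p : X × X // rel p.1 p.2}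

namespace TopRel

variable {X : Type u}

/-- The graph of the relation, i.e. the set of arrows of the groupoid. -/
def Arrow (G : TopRel X) : Type u := {p : X × X // G.rel p.1 p.2}

instance (G : TopRel X) : TopologicalSpace G.Arrow := G.top

/-- The arrow `(x, y)`. -/
def arrow (G : TopRel X) {x y : X} (h : G.rel x y) : G.Arrow := ⟨(x, y), h⟩

/-- The range (first coordinate) of an arrow. -/
def Arrow.range {G : TopRel X} (γ : G.Arrow) : X := γ.1.1

/-- The source (second coordinate) of an arrow. -/
def Arrow.source {G : TopRel X} (γ : G.Arrow) : X := γ.1.2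

/-- The topological relation is an equivalence relation and a locally compact Hausdorff topological
groupoid which is `r`-discrete: the range map is a local homeomorphism (so that counting measures
form a Haar system), and the space of units is open and is a copy of `X`. -/
structure IsRDiscrete [TopologicalSpace X] (G : TopRel X) : Prop where
  equivalence : Equivalence G.rel
  t2 : T2Space G.Arrow
  locallyCompact : LocallyCompactSpace G.Arrow
  continuous_inv : Continuous fun γ : G.Arrow => G.arrow (equivalence.symm γ.2)
  continuous_mul : Continuous
    fun p : {p : G.Arrow × G.Arrow // Arrow.source p.1 = Arrow.range p.2} =>
      (⟨(p.1.1.range, p.1.2.source),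
        equivalence.trans p.1.1.2 ((congrArg (G.rel · p.1.2.source) p.2).mpr p.1.2.2)⟩ : G.Arrow)
  isLocalHomeomorph_range : IsLocalHomeomorph fun γ : G.Arrow => γ.range
  isOpenEmbedding_unit : Topology.IsOpenEmbedding fun x : X => G.arrow (equivalence.refl x)

/-! ### The groupoid C*-algebra -/

/-- The convolution product, `(f * g)(x, y) = ∑_z f(x, z) g(z, y)`; for an `r`-discrete groupoid
and `f`, `g` continuous of compact support, only finitely many terms are nonzero. -/
def conv {G : TopRel X} (f g : G.Arrow → ℂ) (γ : G.Arrow) : ℂ :=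
  ∑ᶠ z : {z : X // G.rel γ.range z ∧ G.rel z γ.source}, f (G.arrow z.2.1) * g (G.arrow z.2.2)

/-- The `I`-norm, `max (sup_x ∑_y |f(x, y)|) (sup_y ∑_x |f(x, y)|)`. -/
def iNorm {G : TopRel X} (f : G.Arrow → ℂ) : ℝ :=
  max (⨆ x : X, ∑ᶠ γ : {γ : G.Arrow // γ.range = x}, ‖f γ.1‖)
    (⨆ y : X, ∑ᶠ γ : {γ : G.Arrow // γ.source = y}, ‖f γ.1‖)

/-- A bounded `*`-representation of the convolution `*`-algebra `C_c(G)` on a Hilbert space. For an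
`r`-discrete groupoid `G`, `C_c(G)` is closed under the product `conv` and under the involution
`f*(x, y) = conj (f(y, x))`. -/
structure BoundedRep (G : TopRel X) where
  H : Type u
  [normedAddCommGroup : NormedAddCommGroup H]
  [innerProductSpace : InnerProductSpace ℂ H]
  [completeSpace : CompleteSpace H]
  toLin : C_c(G.Arrow, ℂ) →ₗ[ℂ] (H →L[ℂ] H)
  map_conv : ∀ f g h : C_c(G.Arrow, ℂ), (∀ γ, h γ = conv f g γ) →
    toLin h = toLin f * toLin g
  map_star : ∀ f g : C_c(G.Arrow, ℂ),
    (∀ (x y : X) (hxy : G.rel x y) (hyx : G.rel y x),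
      g (G.arrow hxy) = starRingEnd ℂ (f (G.arrow hyx))) →
    toLin g = star (toLin f)
  norm_le : ∀ f : C_c(G.Arrow, ℂ), ‖toLin f‖ ≤ iNorm f

attribute [instance] BoundedRep.normedAddCommGroup BoundedRep.innerProductSpace
  BoundedRep.completeSpace

/-- The bounded operators on the direct sum of all bounded representations which respect the
summands: the C*-algebra of norm-bounded families of operators, with the supremum norm. -/
abbrev RepProduct (G : TopRel X) : Type (u + 1) :=
  lp (fun π : BoundedRep G => π.H →L[ℂ] π.H) ∞

/-- The universal representation of `C_c(G)`, the direct sum of all bounded representations. The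
norm of `universalRep G f` is the supremum of the norms `‖π f‖`, for `π` a bounded
representation. -/
def universalRep (G : TopRel X) : C_c(G.Arrow, ℂ) →ₗ[ℂ] RepProduct G where
  toFun f := ⟨fun π => π.toLin f, memℓp_infty ⟨iNorm f, by
    rintro _ ⟨π, rfl⟩
    exact π.norm_le f⟩⟩
  map_add' f g := by
    ext1
    funext π
    exact map_add π.toLin f g
  map_smul' c f := by
    ext1
    funext π
    exact map_smul π.toLin c f

/-- The C*-algebra `C*(G)` of a groupoid: the completion of `C_c(G)` in the norm
`f ↦ sup_π ‖π f‖`, realized as the C*-algebra generated by the image of the universal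
representation. -/
def cstar (G : TopRel X) : NonUnitalStarSubalgebra ℂ (RepProduct G) :=
  (NonUnitalStarAlgebra.adjoin ℂ (Set.range (universalRep G))).topologicalClosure

instance (G : TopRel X) : IsClosed (G.cstar : Set (RepProduct G)) :=
  NonUnitalStarSubalgebra.isClosed_topologicalClosure _

end TopRel

/-! ### AF algebras and AF groupoids -/

/-- A C*-algebra is AF if it is the closure of the union of an increasing sequence of
finite-dimensional C*-subalgebras. -/
def IsAFAlgebra (A : Type*) [NonUnitalCStarAlgebra A] : Prop :=
  ∃ F : ℕ → NonUnitalStarSubalgebra ℂ A, Monotone F ∧ (∀ n, FiniteDimensional ℂ (F n)) ∧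
    Dense (⋃ n, (F n : Set A))

/-- The version of the AF property for C*-algebras which need not be separable: the algebra is the
closure of the union of an upward directed family of finite-dimensional C*-subalgebras. -/
def IsDirectedAFAlgebra (A : Type*) [NonUnitalCStarAlgebra A] : Prop :=
  ∃ F : Set (NonUnitalStarSubalgebra ℂ A), F.Nonempty ∧ DirectedOn (· ≤ ·) F ∧
    (∀ S ∈ F, FiniteDimensional ℂ S) ∧ Dense (⋃ S ∈ F, (S : Set A))

/-- A groupoid is AF if its C*-algebra is AF. -/
def TopRel.IsAF {X : Type u} (G : TopRel X) : Prop := IsAFAlgebra G.cstar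

/-! ### Inverse semigroups of partial homeomorphisms and their groupoids

A partial homeomorphism is an `OpenPartialHomeomorph X X`; two of them are equal as partial maps if
they are related by `≈` (same domain, same values there). -/

section InverseSemigroup

variable {X : Type u} [TopologicalSpace X]

/-- `A(T)`: all restrictions of elements of `T` to clopen subsets of their domains. -/
def clopenRestrictions (T : Set (OpenPartialHomeomorph X X)) : Set (OpenPartialHomeomorph X X) :=
  {ρ | ∃ σ ∈ T, ∃ B : Set X, ∃ hB : IsClopen B, B ⊆ σ.source ∧ ρ ≈ σ.restrOpen B hB.isOpen}

/-- Membership in the inverse semigroup generated by `T`: the smallest set of partial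
homeomorphisms that contains `A(T)` and is closed under inverses and compositions. -/
inductive InInverseSemigroup (T : Set (OpenPartialHomeomorph X X)) :
    OpenPartialHomeomorph X X → Prop
  | of {ρ} : ρ ∈ clopenRestrictions T → InInverseSemigroup T ρ
  | symm {ρ} : InInverseSemigroup T ρ → InInverseSemigroup T ρ.symm
  | comp {ρ ρ'} : InInverseSemigroup T ρ → InInverseSemigroup T ρ' →
      InInverseSemigroup T (ρ.trans ρ')
  | congr {ρ ρ'} : InInverseSemigroup T ρ → ρ ≈ ρ' → InInverseSemigroup T ρ'

/-- The inverse semigroup generated by `T`. -/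
def inverseSemigroup (T : Set (OpenPartialHomeomorph X X)) : Set (OpenPartialHomeomorph X X) :=
  {ρ | InInverseSemigroup T ρ}

/-- The groupoid generated by an inverse semigroup `Z`: the union of the graphs of the elements of
`Z`, with the topology generated by the graphs of the elements of `Z` restricted to clopen sets. -/
def generatedGroupoid (Z : Set (OpenPartialHomeomorph X X)) : TopRel X where
  rel x y := ∃ ρ ∈ Z, x ∈ ρ.source ∧ ρ x = y
  top := TopologicalSpace.generateFrom
    {V | ∃ ρ ∈ Z, ∃ B : Set X, IsClopen B ∧
      V = {p | p.1.1 ∈ ρ.source ∩ B ∧ ρ p.1.1 = p.1.2}}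

end InverseSemigroup

/-! ### The systems of partial homeomorphisms -/

/-- A family of partial homeomorphisms `σ_{r,s}^{(n)}`, `n ≥ 0`, `1 ≤ r ≤ m_n`,
`1 ≤ s ≤ κ(r, n)`, where `σ_{r,s}^{(n)}` has the clopen domain `B(r, n)`, the sets `B(r, n)`
(`1 ≤ r ≤ m_n`) are pairwise disjoint, `m_0 = 1`, `B(1, 0) = X`, and there is a single map at
level `0`. Indices start from `0` instead of `1`, except for `n`. -/
structure PartialSystem (X : Type u) [TopologicalSpace X] where
  m : ℕ → ℕ
  m_pos : ∀ n, 0 < m n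
  m_zero : m 0 = 1
  κ : ∀ n, Fin (m n) → ℕ
  κ_pos : ∀ n r, 0 < κ n r
  κ_zero : ∀ r, κ 0 r = 1
  B : ∀ n, Fin (m n) → Set X
  isClopen_B : ∀ n r, IsClopen (B n r)
  disjoint_B : ∀ n, Pairwise fun r r' => Disjoint (B n r) (B n r')
  B_zero : ∀ r, B 0 r = Set.univ
  σ : ∀ n (r : Fin (m n)), Fin (κ n r) → OpenPartialHomeomorph X X
  source_σ : ∀ n r s, (σ n r s).source = B n r

namespace PartialSystem

variable {X : Type u} [TopologicalSpace X]

/-- `U_n`, the union of the sets `B(r, n)`. -/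
def U (D : PartialSystem X) (n : ℕ) : Set X := ⋃ r, D.B n r

/-- The image `σ_{r,s}^{(n)}(B(r, n))`. -/
def image (D : PartialSystem X) (n : ℕ) (p : Σ r : Fin (D.m n), Fin (D.κ n r)) : Set X :=
  D.σ n p.1 p.2 '' D.B n p.1

/-- The conditions on the system: (i) the first map on each `B(r, n)` is the identity; (ii) for
`n ≥ 1` every `σ_{r,s}^{(n)}` maps `B(r, n)` into some `B(i, n - 1)`; (iii) for `n ≥ 1` the images
of the `σ_{r,s}^{(n)}`, over all `r` and `s`, are pairwise disjoint with union `U_{n-1}`. -/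
structure Conditions (D : PartialSystem X) : Prop where
  first_eq_id : ∀ n r, ∀ x ∈ D.B n r, D.σ n r ⟨0, D.κ_pos n r⟩ x = x
  image_subset : ∀ n p, ∃ i, D.image (n + 1) p ⊆ D.B n i
  disjoint_image : ∀ n, Pairwise fun p q => Disjoint (D.image (n + 1) p) (D.image (n + 1) q)
  iUnion_image : ∀ n, ⋃ p, D.image (n + 1) p = D.U n

/-- The set of all the partial homeomorphisms `σ_{r,s}^{(n)}`. -/
def maps (D : PartialSystem X) : Set (OpenPartialHomeomorph X X) :=
  {ρ | ∃ n r s, ρ = D.σ n r s}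

/-- The groupoid generated by the inverse semigroup generated by the maps `σ_{r,s}^{(n)}`. -/
def groupoid (D : PartialSystem X) : TopRel X := generatedGroupoid (inverseSemigroup D.maps)

end PartialSystem

end

open Filter Set Topology

noncomputable section

/-! ### Groupoids filtered by kernels of local homeomorphisms -/

section Filtration

variable {X : Type u} [TopologicalSpace X]

/-! By (iii) each point of `U_n` lies in exactly one image at level `n + 1`, so it can be carried
back into `U_{n+1}` by the inverse of that map. Iterating gives `φ n = D.toBase n : X → U_n`, which
is locally an element of `S`, hence a local homeomorphism. Each element of `S` preserves the fibres
of some `φ n`, and so `R` is the increasing union of the kernels `ker (φ n) = {(x, y) | φ n x = φ n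
y}`. `AFFiltration` records just this, and all the rest follows from it.

Each kernel is compact and open in `R`, and convergence there is convergence of both coordinates
(`tendsto_arrow`); this gives the topological properties of `R`.

For the C*-algebra, choose a finite clopen partition `q` adapted to `φ n`. The functions on `ker (φ
n)` that depend only on the `q`-classes of the coordinates form a finite-dimensional `*`-algebra
under convolution (`IsBlock.conv`). Every partition has an adapted refinement, so these algebras are
directed. A function in `C_c(R)` lives on one kernel, where it is a uniform limit of block
functions; there the `I`-norm is at most a constant times the sup norm, so the union is dense. A
second countable `X` has only countably many partitions, and a countable directed family can be
replaced by a sequence. -/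

/-- The groupoid generated by `Z` is the increasing union of the kernels of the maps `φ n`, which
locally belong to `Z`. -/
structure AFFiltration (Z : Set (OpenPartialHomeomorph X X)) (φ : ℕ → X → X) : Prop where
  symm_mem : ∀ ρ ∈ Z, ρ.symm ∈ Z
  trans_mem : ∀ ρ ∈ Z, ∀ ρ' ∈ Z, ρ.trans ρ' ∈ Z
  exists_comp_eq : ∀ ρ ∈ Z, ∃ n, ∀ x ∈ ρ.source, φ n (ρ x) = φ n x
  exists_eqOn : ∀ n x, ∃ ρ ∈ Z, x ∈ ρ.source ∧ EqOn ρ (φ n) ρ.source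
  zero : ∀ x, φ 0 x = x
  succ : ∀ n x y, φ n x = φ n y → φ (n + 1) x = φ (n + 1) y

namespace AFFiltration

variable {Z : Set (OpenPartialHomeomorph X X)} {φ : ℕ → X → X} (hF : AFFiltration Z φ)
include hF

lemma mono {m n : ℕ} (hmn : m ≤ n) {x y : X} (h : φ m x = φ m y) : φ n x = φ n y := by
  induction n, hmn using Nat.le_induction with
  | base => exact h
  | succ k _ ih => exact hF.succ k x y ih

lemma continuous (n : ℕ) : Continuous (φ n) := by
  refine continuous_iff_continuousAt.2 fun x => ?_
  obtain ⟨ρ, -, hx, hρ⟩ := hF.exists_eqOn n x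
  refine (ρ.continuousAt hx).congr ?_
  filter_upwards [ρ.open_source.mem_nhds hx] with y hy using hρ hy

lemma exists_injOn (n : ℕ) (x : X) : ∃ V ∈ 𝓝 x, InjOn (φ n) V := by
  obtain ⟨ρ, -, hx, hρ⟩ := hF.exists_eqOn n x
  exact ⟨ρ.source, ρ.open_source.mem_nhds hx, ρ.injOn.congr hρ⟩

lemma isOpenMap (n : ℕ) : IsOpenMap (φ n) := by
  refine isOpenMap_iff_nhds_le.2 fun x => ?_
  obtain ⟨ρ, -, hx, hρ⟩ := hF.exists_eqOn n x
  have hev : (φ n) =ᶠ[𝓝 x] ρ := by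
    filter_upwards [ρ.open_source.mem_nhds hx] with y hy using (hρ hy).symm
  rw [Filter.map_congr hev, ← hρ hx, ρ.map_nhds_eq hx]

/-- Near `x` and near `y` the map `φ n` is given by elements `ρ`, `ρ'` of `Z`; following `ρ` by the
inverse of `ρ'` moves `x` to `y` inside the fibres of `φ n`. -/
lemma rel_of_eq {n : ℕ} {x y : X} (h : φ n x = φ n y) :
    ∃ ρ ∈ Z, x ∈ ρ.source ∧ ρ x = y ∧ ∀ z ∈ ρ.source, φ n z = φ n (ρ z) := by
  obtain ⟨ρ, hρ, hx, hρφ⟩ := hF.exists_eqOn n x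
  obtain ⟨ρ', hρ', hy, hρφ'⟩ := hF.exists_eqOn n y
  have hxy : ρ x = ρ' y := by rw [hρφ hx, hρφ' hy, h]
  refine ⟨ρ.trans ρ'.symm, hF.trans_mem _ hρ _ (hF.symm_mem _ hρ'), ?_, ?_, ?_⟩
  · simp [hx, hxy, hy]
  · simp [hxy, hy]
  · intro z hz
    simp only [OpenPartialHomeomorph.trans_source, OpenPartialHomeomorph.symm_source, mem_inter_iff,
      mem_preimage] at hz
    simp only [OpenPartialHomeomorph.coe_trans, Function.comp_apply]
    rw [← hρφ hz.1, ← hρφ' (ρ'.map_target hz.2), ρ'.right_inv hz.2]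

lemma rel_iff {x y : X} : (generatedGroupoid Z).rel x y ↔ ∃ n, φ n x = φ n y := by
  constructor
  · rintro ⟨ρ, hρ, hx, rfl⟩
    obtain ⟨n, hn⟩ := hF.exists_comp_eq ρ hρ
    exact ⟨n, (hn x hx).symm⟩
  · rintro ⟨n, h⟩
    obtain ⟨ρ, hρ, hx, hxy, -⟩ := hF.rel_of_eq h
    exact ⟨ρ, hρ, hx, hxy⟩

lemma equivalence : Equivalence (generatedGroupoid Z).rel where
  refl x := hF.rel_iff.2 ⟨0, rfl⟩
  symm h := by
    obtain ⟨n, hn⟩ := hF.rel_iff.1 h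
    exact hF.rel_iff.2 ⟨n, hn.symm⟩
  trans h h' := by
    obtain ⟨n, hn⟩ := hF.rel_iff.1 h
    obtain ⟨m, hm⟩ := hF.rel_iff.1 h'
    exact hF.rel_iff.2 ⟨max n m, (hF.mono (le_max_left _ _) hn).trans
      (hF.mono (le_max_right _ _) hm)⟩

/-- Convergence of arrows in a kernel `ker (φ n)` is convergence of both coordinates. -/
lemma tendsto_arrow {Y : Type*} {l : Filter Y} {f : Y → (generatedGroupoid Z).Arrow}
    {γ : (generatedGroupoid Z).Arrow} (hr : Tendsto (fun y => (f y).range) l (𝓝 γ.range))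
    (hs : Tendsto (fun y => (f y).source) l (𝓝 γ.source)) (n : ℕ)
    (h : ∀ᶠ y in l, φ n (f y).range = φ n (f y).source) : Tendsto f l (𝓝 γ) := by
  refine TopologicalSpace.tendsto_nhds_generateFrom_iff.2 ?_
  rintro _ ⟨ρ, hρ, B, hB, rfl⟩ ⟨⟨hx, hxB⟩, hxy⟩
  change γ.range ∈ ρ.source at hx
  change γ.range ∈ B at hxB
  change ρ γ.range = γ.source at hxy
  obtain ⟨k, hk⟩ := hF.exists_comp_eq ρ hρ
  -- At level `max n k` the points `ρ (f y).range` and `(f y).source` have the same image. Both are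
  -- close to `γ.source`, where this map is injective, so they coincide.
  obtain ⟨V, hV, hinj⟩ := hF.exists_injOn (max n k) γ.source
  have hρV : ∀ᶠ y in l, ρ (f y).range ∈ V := by
    have : Tendsto (fun y => ρ (f y).range) l (𝓝 γ.source) := by
      rw [← hxy]
      exact (ρ.continuousAt hx).tendsto.comp hr
    exact this hV
  filter_upwards [h, hr (ρ.open_source.mem_nhds hx), hr (hB.isOpen.mem_nhds hxB), hs hV, hρV]
    with y h1 h2 h3 h4 h5
  refine ⟨⟨h2, h3⟩, hinj h5 h4 ?_⟩
  exact (hF.mono (le_max_right _ _) (hk _ h2)).trans (hF.mono (le_max_left _ _) h1)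

omit hF in
lemma isOpen_graph {ρ : OpenPartialHomeomorph X X} (hρ : ρ ∈ Z) {B : Set X} (hB : IsClopen B) :
    IsOpen {γ : (generatedGroupoid Z).Arrow | γ.range ∈ ρ.source ∩ B ∧ ρ γ.range = γ.source} :=
  TopologicalSpace.isOpen_generateFrom_of_mem ⟨ρ, hρ, B, hB, rfl⟩

/-- The kernel `ker (φ n)` as an open set of arrows. -/
lemma isOpen_ker (n : ℕ) :
    IsOpen {γ : (generatedGroupoid Z).Arrow | φ n γ.range = φ n γ.source} := by
  refine isOpen_iff_mem_nhds.2 fun γ hγ => ?_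
  obtain ⟨ρ, hρ, hx, hxy, hker⟩ := hF.rel_of_eq hγ
  filter_upwards [(isOpen_graph hρ isClopen_univ).mem_nhds (x := γ) ⟨⟨hx, trivial⟩, hxy⟩] with γ' h
  have := hker _ h.1.1
  rwa [h.2] at this

/-- A map into the groupoid is continuous if its coordinates are. -/
lemma continuous_arrow {Y : Type*} [TopologicalSpace Y] {f : Y → (generatedGroupoid Z).Arrow}
    (hr : Continuous fun y => (f y).range) (hs : Continuous fun y => (f y).source)
    (h : ∀ y, ∃ n, ∀ᶠ y' in 𝓝 y, φ n (f y').range = φ n (f y').source) : Continuous f := by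
  refine continuous_iff_continuousAt.2 fun y => ?_
  obtain ⟨n, hn⟩ := h y
  exact hF.tendsto_arrow hr.continuousAt hs.continuousAt n hn

lemma exists_eventually_ker (γ : (generatedGroupoid Z).Arrow) :
    ∃ n, ∀ᶠ γ' in 𝓝 γ, φ n γ'.range = φ n γ'.source := by
  obtain ⟨n, hn⟩ := hF.rel_iff.1 γ.2
  exact ⟨n, (hF.isOpen_ker n).mem_nhds hn⟩

variable (hX : TopologicalSpace.IsTopologicalBasis {V : Set X | IsClopen V})
include hX

omit hF in
lemma continuous_range : Continuous fun γ : (generatedGroupoid Z).Arrow => γ.range := by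
  refine continuous_iff_continuousAt.2 fun γ U hU => ?_
  obtain ⟨B, hB, hxB, hBU⟩ := hX.mem_nhds_iff.1 hU
  obtain ⟨ρ, hρ, hx, hxy⟩ := γ.2
  change ∀ᶠ γ' in 𝓝 γ, γ'.range ∈ U
  filter_upwards [(isOpen_graph hρ hB).mem_nhds (x := γ) ⟨⟨hx, hxB⟩, hxy⟩] with γ' h
  exact hBU h.1.2

omit hF in
lemma continuous_source : Continuous fun γ : (generatedGroupoid Z).Arrow => γ.source := by
  refine continuous_iff_continuousAt.2 fun γ => ?_
  obtain ⟨ρ, hρ, hx, hxy⟩ := γ.2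
  have h1 : ContinuousAt (fun γ' : (generatedGroupoid Z).Arrow => ρ γ'.range) γ :=
    (ρ.continuousAt hx).comp (f := fun γ' : (generatedGroupoid Z).Arrow => γ'.range)
      (continuous_range hX).continuousAt
  refine h1.congr ?_
  filter_upwards [(isOpen_graph hρ isClopen_univ).mem_nhds (x := γ) ⟨⟨hx, trivial⟩, hxy⟩] with γ' h
  exact h.2

omit hF in
lemma t2 [T2Space X] : T2Space (generatedGroupoid Z).Arrow :=
  T2Space.of_injective_continuous (f := fun γ => (γ.range, γ.source))
    (fun _ _ h => Subtype.ext h) ((continuous_range hX).prodMk (continuous_source hX))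

lemma isLocalHomeomorph_range :
    IsLocalHomeomorph fun γ : (generatedGroupoid Z).Arrow => γ.range := by
  have hopen : IsOpenMap fun γ : (generatedGroupoid Z).Arrow => γ.range := by
    refine isOpenMap_iff_nhds_le.2 fun γ U hU => ?_
    obtain ⟨ρ, hρ, hx, hxy⟩ := γ.2
    obtain ⟨n, hn⟩ := hF.exists_comp_eq ρ hρ
    classical
    -- The local section of the range map through `γ`; its value off `ρ.source` is a dummy. Its
    -- continuity at `γ.range` makes the range map open at `γ`.
    let s : X → (generatedGroupoid Z).Arrow := fun x =>
      if h : x ∈ ρ.source then ⟨(x, ρ x), ρ, hρ, h, rfl⟩ else γ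
    have hs : ∀ x, ∀ h : x ∈ ρ.source, s x = ⟨(x, ρ x), ρ, hρ, h, rfl⟩ := fun x h => dif_pos h
    have hsrc := ρ.open_source.mem_nhds hx
    have ht : Tendsto s (𝓝 γ.range) (𝓝 γ) := by
      refine hF.tendsto_arrow (tendsto_id.congr' ?_) ?_ n ?_
      · filter_upwards [hsrc] with x h
        rw [hs x h]; rfl
      · have : Tendsto ρ (𝓝 γ.range) (𝓝 γ.source) := by
          have := (ρ.continuousAt hx).tendsto
          rwa [hxy] at this
        refine this.congr' ?_
        filter_upwards [hsrc] with x h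
        rw [hs x h]; rfl
      · filter_upwards [hsrc] with x h
        rw [hs x h]
        exact (hn x h).symm
    filter_upwards [ht hU, hsrc] with x h h'
    rw [mem_preimage, hs x h'] at h
    exact h
  rw [isLocalHomeomorph_iff_isOpenEmbedding_restrict]
  intro γ
  obtain ⟨ρ, hρ, hx, hxy⟩ := γ.2
  have hV := isOpen_graph hρ isClopen_univ
  refine ⟨_, hV.mem_nhds (x := γ) ⟨⟨hx, trivial⟩, hxy⟩,
    IsOpenEmbedding.of_continuous_injective_isOpenMap
    ((continuous_range hX).comp continuous_subtype_val) ?_ (hopen.domRestrict hV)⟩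
  rintro ⟨a, ha⟩ ⟨b, hb⟩ hab
  change a.range = b.range at hab
  refine Subtype.ext (Subtype.ext (Prod.ext hab ?_))
  have h1 : ρ a.range = a.source := ha.2
  have h2 : ρ b.range = b.source := hb.2
  change a.source = b.source
  rw [← h1, ← h2, hab]

omit hX in
-- A closed subset of `X × X` maps continuously onto the kernel, because one level `n` serves for
-- all its points.
lemma isCompact_ker [CompactSpace X] [T2Space X] (n : ℕ) :
    IsCompact {γ : (generatedGroupoid Z).Arrow | φ n γ.range = φ n γ.source} := by
  have : CompactSpace {p : X × X // φ n p.1 = φ n p.2} :=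
    isCompact_iff_compactSpace.1 (isClosed_eq ((hF.continuous n).comp continuous_fst)
      ((hF.continuous n).comp continuous_snd)).isCompact
  let i : {p : X × X // φ n p.1 = φ n p.2} → (generatedGroupoid Z).Arrow :=
    fun p => ⟨p.1, hF.rel_iff.2 ⟨n, p.2⟩⟩
  have hi : Continuous i := hF.continuous_arrow
    (continuous_fst.comp continuous_subtype_val) (continuous_snd.comp continuous_subtype_val)
    fun y => ⟨n, Eventually.of_forall fun p => p.2⟩
  convert isCompact_range hi
  ext γ
  exact ⟨fun h => ⟨⟨γ.1, h⟩, rfl⟩, by rintro ⟨p, rfl⟩; exact p.2⟩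

lemma isClosed_ker [T2Space X] (n : ℕ) :
    IsClosed {γ : (generatedGroupoid Z).Arrow | φ n γ.range = φ n γ.source} :=
  isClosed_eq ((hF.continuous n).comp (continuous_range hX))
    ((hF.continuous n).comp (continuous_source hX))

lemma locallyCompact [CompactSpace X] [T2Space X] :
    LocallyCompactSpace (generatedGroupoid Z).Arrow := by
  have := AFFiltration.t2 (Z := Z) hX
  have : WeaklyLocallyCompactSpace (generatedGroupoid Z).Arrow := ⟨fun γ => by
    obtain ⟨n, hn⟩ := hF.rel_iff.1 γ.2
    exact ⟨_, hF.isCompact_ker n, (hF.isOpen_ker n).mem_nhds hn⟩⟩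
  infer_instance

/-- Multiplication is continuous for the topology of the groupoid on both sides. -/
lemma continuous_mul : Continuous
    fun p : {p : (generatedGroupoid Z).Arrow × (generatedGroupoid Z).Arrow //
      p.1.source = p.2.range} =>
      (generatedGroupoid Z).arrow (hF.equivalence.trans p.1.1.2
        ((congrArg ((generatedGroupoid Z).rel · p.1.2.source) p.2).mpr p.1.2.2)) := by
  have hr := (continuous_range (Z := Z) hX).comp
    ((continuous_fst (Y := (generatedGroupoid Z).Arrow)).comp
      (continuous_subtype_val (p := fun p => p.1.source = p.2.range)))
  have hs := (continuous_source (Z := Z) hX).comp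
    ((continuous_snd (X := (generatedGroupoid Z).Arrow)).comp
      (continuous_subtype_val (p := fun p => p.1.source = p.2.range)))
  apply hF.continuous_arrow
  · exact hr
  · exact hs
  intro p
  obtain ⟨n, hn⟩ := hF.exists_eventually_ker p.1.1
  obtain ⟨m, hm⟩ := hF.exists_eventually_ker p.1.2
  refine ⟨max n m, ?_⟩
  filter_upwards [(continuous_fst.comp continuous_subtype_val).tendsto p hn,
    (continuous_snd.comp continuous_subtype_val).tendsto p hm] with q h1 h2
  have h3 := hF.mono (le_max_left n m) h1
  have h4 := hF.mono (le_max_right n m) h2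
  refine h3.trans (Eq.trans ?_ h4)
  exact congrArg _ q.2

theorem isRDiscrete [CompactSpace X] [T2Space X] : (generatedGroupoid Z).IsRDiscrete where
  equivalence := hF.equivalence
  t2 := AFFiltration.t2 hX
  locallyCompact := hF.locallyCompact hX
  continuous_inv := by
    refine hF.continuous_arrow (continuous_source hX) (continuous_range hX) fun γ => ?_
    obtain ⟨n, hn⟩ := hF.exists_eventually_ker γ
    exact ⟨n, hn.mono fun γ' h => h.symm⟩
  continuous_mul := by
    -- The codomain in this field carries the topology induced from `X × X`, so the two coordinates
    -- suffice; the lemma `continuous_mul` is the stronger statement.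
    exact ((continuous_range hX).comp (hF.continuous_mul hX)).prodMk
      ((continuous_source hX).comp (hF.continuous_mul hX)) |>.subtype_mk _
  isLocalHomeomorph_range := hF.isLocalHomeomorph_range hX
  isOpenEmbedding_unit := by
    refine .of_continuous_injective_isOpenMap
      (hF.continuous_arrow continuous_id continuous_id fun x =>
        ⟨0, Eventually.of_forall fun _ => rfl⟩)
      (fun x y h => congrArg TopRel.Arrow.range h) fun U hU => ?_
    -- As `φ 0` is the identity, `ker (φ 0)` is the diagonal.
    convert (hU.preimage (continuous_range hX)).inter (hF.isOpen_ker 0) using 1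
    ext γ
    constructor
    · rintro ⟨x, hx, rfl⟩
      exact ⟨hx, rfl⟩
    · rintro ⟨h1, h2⟩
      refine ⟨γ.range, h1, Subtype.ext (Prod.ext rfl ?_)⟩
      change φ 0 γ.range = φ 0 γ.source at h2
      rwa [hF.zero, hF.zero] at h2

end AFFiltration

end Filtration

/-! ### Partitions adapted to a local homeomorphism -/

section Partition

variable {X : Type u} [TopologicalSpace X]

lemma DiscreteQuotient.proj_eq_of_le {p q : DiscreteQuotient X} (h : p ≤ q) {x y : X}
    (hxy : p.proj x = p.proj y) : q.proj x = q.proj y := by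
  rw [← DiscreteQuotient.ofLE_proj h, hxy, DiscreteQuotient.ofLE_proj]

lemma DiscreteQuotient.proj_ofIsClopen_eq_iff {A : Set X} (hA : IsClopen A) {x y : X} :
    (DiscreteQuotient.ofIsClopen hA).proj x = (DiscreteQuotient.ofIsClopen hA).proj y ↔
      (x ∈ A ↔ y ∈ A) :=
  Quotient.eq''

/-- The partition `q` separates the points of each fibre of `φ`, and the fibres of `φ` over the
images of equivalent points meet the same classes. -/
structure DiscreteQuotient.IsAdapted (q : DiscreteQuotient X) (φ : X → X) : Prop where
  eq_of_proj_eq : ∀ x y, φ x = φ y → q.proj x = q.proj y → x = y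
  exists_proj_eq : ∀ x x' y, q.proj x = q.proj x' → φ x = φ y →
    ∃ y', φ x' = φ y' ∧ q.proj y' = q.proj y

variable [CompactSpace X] (hX : TopologicalSpace.IsTopologicalBasis {V : Set X | IsClopen V})

include hX in
/-- A relation which holds near each point of the diagonal holds on the classes of some
partition. -/
lemma DiscreteQuotient.exists_forall_of_nhds {P : X → X → Prop}
    (h : ∀ x, ∃ V ∈ 𝓝 x, ∀ a ∈ V, ∀ b ∈ V, P a b) :
    ∃ q : DiscreteQuotient X, ∀ a b, q.proj a = q.proj b → P a b := by
  have h' : ∀ x, ∃ V : Set X, IsClopen V ∧ x ∈ V ∧ ∀ a ∈ V, ∀ b ∈ V, P a b := fun x => by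
    obtain ⟨V, hV, hP⟩ := h x
    obtain ⟨B, hB, hxB, hBV⟩ := hX.mem_nhds_iff.1 hV
    exact ⟨B, hB, hxB, fun a ha b hb => hP a (hBV ha) b (hBV hb)⟩
  choose V hV hxV hP using h'
  obtain ⟨t, ht⟩ := CompactSpace.elim_nhds_subcover V fun x => (hV x).isOpen.mem_nhds (hxV x)
  -- A class of the common refinement lies inside or outside each `V x`, `x ∈ t`, and these sets
  -- cover `X`.
  refine ⟨t.inf fun x => DiscreteQuotient.ofIsClopen (hV x), fun a b hab => ?_⟩
  have ha : a ∈ ⋃ x ∈ t, V x := by rw [ht]; trivial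
  simp only [mem_iUnion] at ha
  obtain ⟨x, hx, hax⟩ := ha
  have := DiscreteQuotient.proj_eq_of_le
    (Finset.inf_le (f := fun x => DiscreteQuotient.ofIsClopen (hV x)) hx) hab
  exact hP x a hax b (((DiscreteQuotient.proj_ofIsClopen_eq_iff (hV x)).1 this).1 hax)

include hX in
/-- Every partition has an adapted refinement. -/
lemma DiscreteQuotient.exists_isAdapted_le [T2Space X] {φ : X → X} (hc : Continuous φ)
    (ho : IsOpenMap φ) (hi : ∀ x, ∃ V ∈ 𝓝 x, InjOn φ V) (q₀ : DiscreteQuotient X) :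
    ∃ q ≤ q₀, q.IsAdapted φ := by
  obtain ⟨q₁, hq₁⟩ := DiscreteQuotient.exists_forall_of_nhds hX
    (P := fun a b => φ a = φ b → a = b) fun x => by
      obtain ⟨V, hV, hinj⟩ := hi x
      exact ⟨V, hV, fun a ha b hb h => hinj ha hb h⟩
  let p := q₀ ⊓ q₁
  -- `S x` is the set of `p`-classes met by the fibre through `x`. It is locally constant because
  -- `φ`, being open and closed, sends clopen sets to clopen sets.
  let S : X → Set p := fun x => {c | ∃ y, φ x = φ y ∧ p.proj y = c}
  have hS : ∀ c, IsClopen {x | c ∈ S x} := fun c => by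
    have h1 := p.isClopen_preimage {c}
    have h2 : IsClopen (φ '' (p.proj ⁻¹' {c})) :=
      ⟨hc.isClosedMap _ h1.1, ho _ h1.2⟩
    convert h2.preimage hc using 1
    ext x
    constructor
    · rintro ⟨y, h, h'⟩
      exact ⟨y, h', h.symm⟩
    · rintro ⟨y, h', h⟩
      exact ⟨y, h.symm, h'⟩
  let f : LocallyConstant X (p × Set p) := ⟨fun x => (p.proj x, S x), by
    have h1 : IsLocallyConstant S := (IsLocallyConstant.iff_eventually_eq _).2 fun x => by
      have : ∀ᶠ y in 𝓝 x, ∀ c, (c ∈ S y ↔ c ∈ S x) := eventually_all.2 fun c => by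
        by_cases hx : c ∈ S x
        · filter_upwards [(hS c).isOpen.mem_nhds hx] with y hy
          exact iff_of_true hy hx
        · filter_upwards [(hS c).compl.isOpen.mem_nhds hx] with y hy
          exact iff_of_false hy hx
      exact this.mono fun y hy => Set.ext hy
    exact p.proj_isLocallyConstant.prodMk h1⟩
  have hf : ∀ x y, f.discreteQuotient.proj x = f.discreteQuotient.proj y ↔ f x = f y :=
    fun x y => Quotient.eq''
  have hfp : ∀ x y, f x = f y ↔ p.proj x = p.proj y ∧ S x = S y := fun x y => Prod.ext_iff
  have hle : f.discreteQuotient ≤ p := fun x y (hxy : f x = f y) =>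
    Quotient.exact ((hfp x y).1 hxy).1
  refine ⟨f.discreteQuotient, hle.trans inf_le_left, ⟨fun x y h hq => ?_, fun x x' y hq h => ?_⟩⟩
  · exact hq₁ x y (DiscreteQuotient.proj_eq_of_le (hle.trans inf_le_right) hq) h
  · have h1 := ((hfp _ _).1 ((hf _ _).1 hq)).2
    have h2 : p.proj y ∈ S x' := h1 ▸ ⟨y, h, rfl⟩
    obtain ⟨y', hy', hp⟩ := h2
    -- `S` is constant on the fibres of `φ`, so refining `p` once by `S` is enough: `S y' = S x' = S
    -- x = S y`.
    refine ⟨y', hy', (hf _ _).2 ((hfp _ _).2 ⟨hp, ?_⟩)⟩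
    have h3 : ∀ {a b : X}, φ a = φ b → S a = S b := fun h => by simp only [S, h]
    rw [← h3 hy', ← h1, h3 h]

end Partition

/-! ### Partitions controlling arrows of a kernel -/

namespace AFFiltration

variable {X : Type u} [TopologicalSpace X] [CompactSpace X]
  {Z : Set (OpenPartialHomeomorph X X)} {φ : ℕ → X → X} (hF : AFFiltration Z φ)
  (hX : TopologicalSpace.IsTopologicalBasis {V : Set X | IsClopen V})
include hF hX

lemma exists_isAdapted_le [T2Space X] (n : ℕ) (q₀ : DiscreteQuotient X) :
    ∃ q ≤ q₀, q.IsAdapted (φ n) :=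
  DiscreteQuotient.exists_isAdapted_le hX (hF.continuous n) (hF.isOpenMap n) (hF.exists_injOn n) q₀

/-- A relation between arrows which holds near each point of the diagonal holds, for some partition
of `X`, for all pairs of arrows of `ker (φ n)` whose coordinates are in the same classes. -/
lemma exists_forall_of_nhds [T2Space X] (n : ℕ)
    {P : (generatedGroupoid Z).Arrow → (generatedGroupoid Z).Arrow → Prop}
    (h : ∀ γ, ∃ V ∈ 𝓝 γ, ∀ a ∈ V, ∀ b ∈ V, P a b) :
    ∃ q : DiscreteQuotient X, ∀ a b : (generatedGroupoid Z).Arrow,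
      φ n a.range = φ n a.source → φ n b.range = φ n b.source →
      q.proj a.range = q.proj b.range → q.proj a.source = q.proj b.source → P a b := by
  have h' : ∀ γ : (generatedGroupoid Z).Arrow, ∃ A B : Set X, IsClopen A ∧ IsClopen B ∧
      γ.range ∈ A ∧ γ.source ∈ B ∧ ∀ a b : (generatedGroupoid Z).Arrow,
      φ n a.range = φ n a.source → φ n b.range = φ n b.source →
      a.range ∈ A → b.range ∈ A → a.source ∈ B → b.source ∈ B → P a b := fun γ => by
    obtain ⟨V, hV, hP⟩ := h γ
    -- Arrows of the kernel whose coordinates approach those of `γ`. By `tendsto_arrow` they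
    -- converge to `γ`, so a product neighbourhood meets the kernel inside `V`.
    let l := comap (fun a : (generatedGroupoid Z).Arrow => (a.range, a.source))
      (𝓝 (γ.range, γ.source)) ⊓ 𝓟 {a | φ n a.range = φ n a.source}
    have hl : Tendsto (fun a : (generatedGroupoid Z).Arrow => (a.range, a.source)) l
      (𝓝 (γ.range, γ.source)) := tendsto_comap.mono_left inf_le_left
    have hid : Tendsto id l (𝓝 γ) :=
      hF.tendsto_arrow hl.fst_nhds hl.snd_nhds n (mem_inf_of_right (mem_principal_self _))
    obtain ⟨W, hW, hWV⟩ := mem_comap.1 (mem_inf_principal.1 (hid hV))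
    rw [nhds_prod_eq] at hW
    obtain ⟨A, hA, B, hB, hAB⟩ := mem_prod_iff.1 hW
    obtain ⟨A', hA', hxA, hAA⟩ := hX.mem_nhds_iff.1 hA
    obtain ⟨B', hB', hyB, hBB⟩ := hX.mem_nhds_iff.1 hB
    refine ⟨A', B', hA', hB', hxA, hyB, fun a b ha hb h1 h2 h3 h4 => ?_⟩
    exact hP _ (hWV (hAB (mk_mem_prod (hAA h1) (hBB h3))) ha)
      _ (hWV (hAB (mk_mem_prod (hAA h2) (hBB h4))) hb)
  choose A B hA hB hxA hyB hP using h'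
  obtain ⟨t, ht⟩ := (hF.isCompact_ker n).elim_nhds_subcover
    (fun γ => {γ' | γ'.range ∈ A γ} ∩ {γ' | γ'.source ∈ B γ}) fun γ _ =>
      (((hA γ).isOpen.preimage (continuous_range hX)).inter
        ((hB γ).isOpen.preimage (continuous_source hX))).mem_nhds ⟨hxA γ, hyB γ⟩
  let Q : (generatedGroupoid Z).Arrow → DiscreteQuotient X := fun γ =>
    DiscreteQuotient.ofIsClopen (hA γ) ⊓ DiscreteQuotient.ofIsClopen (hB γ)
  refine ⟨t.inf Q, fun a b ha hb hr hs => ?_⟩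
  have h1 := ht.2 ha
  simp only [mem_iUnion] at h1
  obtain ⟨γ, hγ, haA, haB⟩ := h1
  have hle : t.inf Q ≤ Q γ := Finset.inf_le hγ
  have h2 := (DiscreteQuotient.proj_ofIsClopen_eq_iff (hA γ)).1
    (DiscreteQuotient.proj_eq_of_le (hle.trans inf_le_left) hr)
  have h3 := (DiscreteQuotient.proj_ofIsClopen_eq_iff (hB γ)).1
    (DiscreteQuotient.proj_eq_of_le (hle.trans inf_le_right) hs)
  exact hP γ a b ha hb haA (h2.1 haA) haB (h3.1 haB)

end AFFiltration

/-! ### Sums over fibres -/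

lemma finsum_le_card_mul {ι κ : Type*} [Finite κ] {u : ι → ℝ} {δ : ℝ} (e : ι → κ)
    (hδ : 0 ≤ δ) (he : InjOn e (Function.support u)) (hu : ∀ i, u i ≤ δ) :
    ∑ᶠ i, u i ≤ Nat.card κ * δ := by
  classical
  have : Fintype κ := Fintype.ofFinite κ
  have hfin : (Function.support u).Finite := Set.Finite.of_injOn (mapsTo_univ e _) he finite_univ
  rw [finsum_eq_sum_of_support_subset (s := hfin.toFinset) _ (by simp)]
  refine (Finset.sum_le_card_nsmul _ _ δ fun i _ => hu i).trans ?_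
  rw [nsmul_eq_mul, Nat.card_eq_fintype_card]
  refine mul_le_mul_of_nonneg_right ?_ hδ
  exact_mod_cast Finset.card_le_card_of_injOn (t := Finset.univ) e (fun _ _ => Finset.mem_univ _)
    (by simpa using he)

/-! ### Convolution and the universal representation -/

namespace TopRel

variable {X : Type u} {G : TopRel X}

/-- The extension by zero of a function on the arrows. -/
def extend (f : G.Arrow → ℂ) (x y : X) : ℂ :=
  open Classical in if h : G.rel x y then f (G.arrow h) else 0

lemma extend_of_rel (f : G.Arrow → ℂ) {x y : X} (h : G.rel x y) :
    extend f x y = f (G.arrow h) := dif_pos h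

/-- With zero extensions the index set no longer depends on `γ`, so sums at different arrows can be
compared. -/
lemma conv_eq_finsum (f g : G.Arrow → ℂ) (γ : G.Arrow) :
    conv f g γ = ∑ᶠ z, extend f γ.range z * extend g z γ.source := by
  have h1 : conv f g γ = ∑ᶠ z : {z : X | G.rel γ.range z ∧ G.rel z γ.source},
      extend f γ.range z * extend g z γ.source :=
    finsum_congr fun z => by rw [extend_of_rel f z.2.1, extend_of_rel g z.2.2]
  rw [h1, finsum_set_coe_eq_finsum_mem
    (f := fun z => extend f γ.range z * extend g z γ.source)]
  rw [finsum_mem_def, indicator_eq_self.2]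
  intro z hz
  rw [Function.mem_support] at hz
  by_contra h
  rw [mem_ofPred_eq, not_and_or] at h
  rcases h with h | h
  · exact hz (by rw [extend, dif_neg h, zero_mul])
  · exact hz (by rw [extend, extend, dif_neg h, mul_zero])

lemma universalRep_eq_mul {f g h : C_c(G.Arrow, ℂ)} (H : ∀ γ, h γ = conv f g γ) :
    universalRep G h = universalRep G f * universalRep G g := by
  ext1
  funext π
  exact π.map_conv f g h H

lemma universalRep_eq_star {f g : C_c(G.Arrow, ℂ)}
    (H : ∀ (x y : X) (hxy : G.rel x y) (hyx : G.rel y x),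
      g (G.arrow hxy) = starRingEnd ℂ (f (G.arrow hyx))) :
    universalRep G g = star (universalRep G f) := by
  ext1
  funext π
  exact π.map_star f g H

lemma norm_universalRep_le {f : C_c(G.Arrow, ℂ)} {C : ℝ} (hC : 0 ≤ C) (h : iNorm f ≤ C) :
    ‖universalRep G f‖ ≤ C :=
  lp.norm_le_of_forall_le hC fun π => (π.norm_le f).trans h

lemma universalRep_mem_cstar (f : C_c(G.Arrow, ℂ)) : universalRep G f ∈ G.cstar :=
  NonUnitalStarSubalgebra.le_topologicalClosure _
    (NonUnitalStarAlgebra.subset_adjoin ℂ _ (mem_range_self f))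

/-! ### Block functions -/

/-- Functions which vanish off the kernel of `φ`, and whose values on the kernel only depend on the
classes of the coordinates. -/
structure IsBlock [TopologicalSpace X] (φ : X → X) (q : DiscreteQuotient X)
    (f : G.Arrow → ℂ) : Prop where
  eq_zero : ∀ γ : G.Arrow, φ γ.range ≠ φ γ.source → f γ = 0
  eq_of_proj_eq : ∀ a b : G.Arrow, φ a.range = φ a.source → φ b.range = φ b.source →
    q.proj a.range = q.proj b.range → q.proj a.source = q.proj b.source → f a = f b

section Block

variable [TopologicalSpace X] {φ : X → X} {q : DiscreteQuotient X}

/-- The value of `f` at some arrow of the kernel of `φ` with coordinates in given classes. -/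
def coeff (φ : X → X) (q : DiscreteQuotient X) (f : G.Arrow → ℂ) (c : q × q) : ℂ :=
  open Classical in
  if h : ∃ γ : G.Arrow, φ γ.range = φ γ.source ∧ q.proj γ.range = c.1 ∧ q.proj γ.source = c.2 then
    f h.choose else 0

lemma exists_coeff_eq (f : G.Arrow → ℂ) {γ : G.Arrow} (hγ : φ γ.range = φ γ.source) :
    ∃ γ' : G.Arrow, φ γ'.range = φ γ'.source ∧ q.proj γ'.range = q.proj γ.range ∧
      q.proj γ'.source = q.proj γ.source ∧
      coeff φ q f (q.proj γ.range, q.proj γ.source) = f γ' := by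
  have h : ∃ γ' : G.Arrow, φ γ'.range = φ γ'.source ∧ q.proj γ'.range = q.proj γ.range ∧
    q.proj γ'.source = q.proj γ.source := ⟨γ, hγ, rfl, rfl⟩
  exact ⟨h.choose, h.choose_spec.1, h.choose_spec.2.1, h.choose_spec.2.2, dif_pos h⟩

lemma IsBlock.coeff_eq {f : G.Arrow → ℂ} (hf : IsBlock φ q f) {γ : G.Arrow}
    (hγ : φ γ.range = φ γ.source) : coeff φ q f (q.proj γ.range, q.proj γ.source) = f γ := by
  obtain ⟨γ', h1, h2, h3, h4⟩ := exists_coeff_eq (q := q) f hγ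
  rw [h4, hf.eq_of_proj_eq _ _ h1 hγ h2 h3]

/-- Adaptedness gives a class-preserving bijection `e` from the fibre through `a.range` to the fibre
through `b.range`; it matches the two convolution sums term by term. -/
lemma IsBlock.conv {f g : G.Arrow → ℂ} (hq : q.IsAdapted φ) (hf : IsBlock φ q f)
    (hg : IsBlock φ q g) (hrel : ∀ x y, φ x = φ y → G.rel x y) : IsBlock φ q (conv f g) := by
  have hzero : ∀ {f : G.Arrow → ℂ}, IsBlock φ q f → ∀ {x y}, φ x ≠ φ y → extend f x y = 0 := by
    intro f hf x y h
    by_cases hxy : G.rel x y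
    · rw [extend_of_rel f hxy]
      exact hf.eq_zero _ h
    · exact dif_neg hxy
  have heq : ∀ {f : G.Arrow → ℂ}, IsBlock φ q f → ∀ {x y x' y'}, φ x = φ y → φ x' = φ y' →
      q.proj x = q.proj x' → q.proj y = q.proj y' → extend f x y = extend f x' y' := by
    intro f hf x y x' y' h h' hx hy
    rw [extend_of_rel f (hrel _ _ h), extend_of_rel f (hrel _ _ h')]
    exact hf.eq_of_proj_eq _ _ h h' hx hy
  have hmem : ∀ γ : G.Arrow, TopRel.conv f g γ =
      ∑ᶠ z ∈ {z | φ γ.range = φ z}, extend f γ.range z * extend g z γ.source := by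
    intro γ
    rw [conv_eq_finsum, finsum_mem_def, indicator_eq_self.2]
    intro z hz
    rw [Function.mem_support] at hz
    by_contra h
    exact hz (by rw [hzero hf h, zero_mul])
  constructor
  · intro γ hγ
    rw [conv_eq_finsum]
    refine finsum_eq_zero_of_forall_eq_zero fun z => ?_
    by_cases h : φ γ.range = φ z
    · rw [hzero hg (h ▸ hγ), mul_zero]
    · rw [hzero hf h, zero_mul]
  · intro a b ha hb hr hs
    rw [hmem, hmem]
    choose! e he using fun z (hz : φ a.range = φ z) => hq.exists_proj_eq _ _ z hr hz
    refine finsum_mem_eq_of_bijOn e ⟨fun z hz => (he z hz).1, fun z hz w hw h => ?_,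
      fun w hw => ?_⟩ fun z hz => ?_
    · refine hq.eq_of_proj_eq z w (Eq.trans (Eq.symm hz) hw) ?_
      rw [← (he z hz).2, h, (he w hw).2]
    · obtain ⟨z, hz, hzw⟩ := hq.exists_proj_eq _ _ w hr.symm hw
      refine ⟨z, hz, hq.eq_of_proj_eq _ _ ((he z hz).1.symm.trans hw) ?_⟩
      rw [(he z hz).2, hzw]
    · rw [heq hf hz (he z hz).1 hr (he z hz).2.symm,
        heq hg (Eq.trans (Eq.symm hz) ha) ((he z hz).1.symm.trans hb) (he z hz).2.symm hs]

lemma IsBlock.star {f : G.Arrow → ℂ} (hf : IsBlock φ q f)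
    (hsymm : ∀ {x y}, G.rel x y → G.rel y x) :
    IsBlock φ q fun γ => starRingEnd ℂ (f (G.arrow (hsymm γ.2))) := by
  constructor
  · intro γ hγ
    rw [hf.eq_zero (G.arrow (hsymm γ.2)) (Ne.symm hγ), map_zero]
  · intro a b ha hb hr hs
    rw [hf.eq_of_proj_eq (G.arrow (hsymm a.2)) (G.arrow (hsymm b.2))
      (Eq.symm ha) (Eq.symm hb) hs hr]

variable (G φ q) in
/-- The block functions as a subspace of `C_c(G)`. -/
def blockSpace : Submodule ℂ C_c(G.Arrow, ℂ) where
  carrier := {f | IsBlock φ q f}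
  zero_mem' := ⟨fun _ _ => rfl, fun _ _ _ _ _ _ => rfl⟩
  add_mem' {f g} hf hg := by
    constructor
    · intro γ hγ
      rw [CompactlySupportedContinuousMap.add_apply, hf.eq_zero γ hγ, hg.eq_zero γ hγ, add_zero]
    · intro a b h1 h2 h3 h4
      rw [CompactlySupportedContinuousMap.add_apply, CompactlySupportedContinuousMap.add_apply,
        hf.eq_of_proj_eq a b h1 h2 h3 h4, hg.eq_of_proj_eq a b h1 h2 h3 h4]
  smul_mem' c f hf := by
    constructor
    · intro γ hγ
      rw [CompactlySupportedContinuousMap.smul_apply, hf.eq_zero γ hγ, smul_zero]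
    · intro a b h1 h2 h3 h4
      rw [CompactlySupportedContinuousMap.smul_apply, CompactlySupportedContinuousMap.smul_apply,
        hf.eq_of_proj_eq a b h1 h2 h3 h4]

instance finiteDimensional_blockSpace [CompactSpace X] :
    FiniteDimensional ℂ (blockSpace G φ q) := by
  -- The arrow chosen in `coeff` does not depend on `f`, so `coeff` is linear in `f`.
  let L : blockSpace G φ q →ₗ[ℂ] (q × q → ℂ) :=
    { toFun := fun f => coeff φ q f.1
      map_add' := fun f g => by
        funext c
        simp only [coeff, Pi.add_apply]
        split_ifs <;> simp
      map_smul' := fun r f => by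
        funext c
        simp only [coeff, Pi.smul_apply, RingHom.id_apply]
        split_ifs <;> simp }
  refine FiniteDimensional.of_injective L fun f g hfg => ?_
  refine Subtype.ext (CompactlySupportedContinuousMap.ext fun γ => ?_)
  by_cases hγ : φ γ.range = φ γ.source
  · rw [← IsBlock.coeff_eq f.2 hγ, ← IsBlock.coeff_eq g.2 hγ]
    exact congrFun hfg _
  · rw [IsBlock.eq_zero f.2 γ hγ, IsBlock.eq_zero g.2 γ hγ]

/-- An arrow of the kernel with a given range is determined by the class of its source, and
conversely, so each sum has at most `Nat.card q` nonzero terms. -/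
lemma iNorm_le_of_isAdapted [CompactSpace X] (hq : q.IsAdapted φ) {f : G.Arrow → ℂ} {δ : ℝ}
    (hδ : 0 ≤ δ) (hf : ∀ γ : G.Arrow, φ γ.range ≠ φ γ.source → f γ = 0) (hfδ : ∀ γ, ‖f γ‖ ≤ δ) :
    iNorm f ≤ Nat.card q * δ := by
  have hker : ∀ γ : G.Arrow, ‖f γ‖ ≠ 0 → φ γ.range = φ γ.source := fun γ h => by
    by_contra h'
    exact h (by rw [hf γ h', norm_zero])
  refine max_le (Real.iSup_le (fun x => ?_) (by positivity))
    (Real.iSup_le (fun x => ?_) (by positivity))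
  · refine finsum_le_card_mul (fun γ => q.proj γ.1.source) hδ ?_ fun γ => hfδ γ.1
    intro a ha b hb hab
    have hr : a.1.range = b.1.range := a.2.trans b.2.symm
    refine Subtype.ext (Subtype.ext (Prod.ext hr (hq.eq_of_proj_eq _ _ ?_ hab)))
    exact (hker a.1 ha).symm.trans ((congrArg φ hr).trans (hker b.1 hb))
  · refine finsum_le_card_mul (fun γ => q.proj γ.1.range) hδ ?_ fun γ => hfδ γ.1
    intro a ha b hb hab
    have hr : a.1.source = b.1.source := a.2.trans b.2.symm
    refine Subtype.ext (Subtype.ext (Prod.ext (hq.eq_of_proj_eq _ _ ?_ hab) hr))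
    exact (hker a.1 ha).trans ((congrArg φ hr).trans (hker b.1 hb).symm)

end Block

end TopRel

/-! ### AF algebras from directed families -/

section Directed

variable {A B ι : Type*} [NonUnitalCStarAlgebra A] [NonUnitalCStarAlgebra B]

/-- The finite-dimensional algebras are built in `RepProduct` and pulled back along the inclusion of
`cstar`. -/
lemma finiteDimensional_comap_of_injective {f : A →⋆ₙₐ[ℂ] B} (hf : Function.Injective f)
    (F : NonUnitalStarSubalgebra ℂ B) [FiniteDimensional ℂ F] :
    FiniteDimensional ℂ (F.comap f) := by
  let L : F.comap f →ₗ[ℂ] F :=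
    { toFun := fun a => ⟨f a.1, a.2⟩
      map_add' := fun a b => Subtype.ext (map_add f a.1 b.1)
      map_smul' := fun c a => Subtype.ext (map_smul f c a.1) }
  exact FiniteDimensional.of_injective L fun a b h =>
    Subtype.ext (hf (congrArg Subtype.val h))

variable [Nonempty ι] (f : A →⋆ₙₐ[ℂ] B) (hf : Isometry f) {F : ι → NonUnitalStarSubalgebra ℂ B}
  [∀ i, FiniteDimensional ℂ (F i)] (hF : Directed (· ≤ ·) F)
  (hle : ∀ i, ∀ b ∈ F i, b ∈ range f) (hcl : ∀ a, f a ∈ closure (⋃ i, (F i : Set B)))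

include hF in
omit [Nonempty ι] [∀ i, FiniteDimensional ℂ (F i)] in
lemma directed_comap : Directed (· ≤ ·) fun i => (F i).comap f := fun i j => by
  obtain ⟨k, hik, hjk⟩ := hF i j
  exact ⟨k, fun a ha => hik ha, fun a ha => hjk ha⟩

include hf hle hcl in
omit [Nonempty ι] [∀ i, FiniteDimensional ℂ (F i)] in
lemma dense_iUnion_comap : Dense (⋃ i, ((F i).comap f : Set A)) := by
  intro a
  rw [Metric.mem_closure_iff]
  intro ε hε
  obtain ⟨b, hb, hab⟩ := Metric.mem_closure_iff.1 (hcl a) ε hε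
  obtain ⟨i, hi⟩ := mem_iUnion.1 hb
  obtain ⟨a', rfl⟩ := hle i b hi
  exact ⟨a', mem_iUnion.2 ⟨i, hi⟩, by rwa [hf.dist_eq] at hab⟩

include hf hF hle hcl

lemma isDirectedAFAlgebra_of_directed : IsDirectedAFAlgebra A := by
  refine ⟨range fun i => (F i).comap f, range_nonempty _,
    (directed_comap f hF).directedOn_range, ?_, ?_⟩
  · rintro _ ⟨i, rfl⟩
    exact finiteDimensional_comap_of_injective hf.injective (F i)
  · rw [biUnion_range]
    exact dense_iUnion_comap f hf hle hcl

lemma isAFAlgebra_of_directed [Countable ι] : IsAFAlgebra A := by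
  have := Encodable.ofCountable ι
  have := Classical.inhabited_of_nonempty ‹Nonempty ι›
  have hdir := directed_comap f hF
  refine ⟨_, hdir.sequence_mono,
    fun n => finiteDimensional_comap_of_injective hf.injective (F _),
    (dense_iUnion_comap f hf hle hcl).mono (iUnion_subset fun i => ?_)⟩
  exact (SetLike.coe_subset_coe.2 (hdir.le_sequence i)).trans (subset_iUnion
    (fun n => (((fun i => (F i).comap f) ∘ hdir.sequence _) n : Set A)) _)

end Directed

/-! ### Finite-dimensional subalgebras of the groupoid C*-algebra -/

namespace AFFiltration

variable {X : Type u} [TopologicalSpace X] [CompactSpace X] [T2Space X]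
  {Z : Set (OpenPartialHomeomorph X X)} {φ : ℕ → X → X} (hF : AFFiltration Z φ)
  (hX : TopologicalSpace.IsTopologicalBasis {V : Set X | IsClopen V})
include hF hX

/-- A block function is locally constant because the kernel is clopen and the classes are open. -/
lemma exists_cc_of_isBlock {n : ℕ} {q : DiscreteQuotient X}
    {f : (generatedGroupoid Z).Arrow → ℂ} (hf : TopRel.IsBlock (φ n) q f) :
    ∃ g : C_c((generatedGroupoid Z).Arrow, ℂ), ⇑g = f := by
  have hc : Continuous f := by
    refine continuous_iff_continuousAt.2 fun γ => ?_
    refine (tendsto_const_nhds (x := f γ)).congr' ?_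
    by_cases hγ : φ n γ.range = φ n γ.source
    · have h1 : ∀ᶠ γ' : (generatedGroupoid Z).Arrow in 𝓝 γ, q.proj γ'.range = q.proj γ.range :=
        ((q.isOpen_preimage {q.proj γ.range}).preimage (continuous_range hX)).mem_nhds
          (mem_singleton (q.proj γ.range))
      have h2 : ∀ᶠ γ' : (generatedGroupoid Z).Arrow in 𝓝 γ, q.proj γ'.source = q.proj γ.source :=
        ((q.isOpen_preimage {q.proj γ.source}).preimage (continuous_source hX)).mem_nhds
          (mem_singleton (q.proj γ.source))
      filter_upwards [(hF.isOpen_ker n).mem_nhds hγ, h1, h2] with γ' h3 h4 h5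
      exact hf.eq_of_proj_eq _ _ hγ h3 h4.symm h5.symm
    · filter_upwards [(hF.isClosed_ker hX n).isOpen_compl.mem_nhds hγ] with γ' h
      rw [hf.eq_zero γ hγ, hf.eq_zero γ' h]
  exact ⟨⟨⟨f, hc⟩, HasCompactSupport.intro' (hF.isCompact_ker n) (hF.isClosed_ker hX n)
    fun γ hγ => hf.eq_zero γ hγ⟩, rfl⟩

/-- The image of the block functions for an adapted partition, a finite-dimensional C*-subalgebra of
the groupoid C*-algebra. -/
def blockAlgebra (i : {p : ℕ × DiscreteQuotient X // p.2.IsAdapted (φ p.1)}) :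
    NonUnitalStarSubalgebra ℂ (TopRel.RepProduct (generatedGroupoid Z)) where
  toSubmodule := (TopRel.blockSpace (generatedGroupoid Z) (φ i.1.1) i.1.2).map
    (TopRel.universalRep (generatedGroupoid Z))
  mul_mem' := by
    rintro _ _ ⟨f, hf, rfl⟩ ⟨g, hg, rfl⟩
    have hb := TopRel.IsBlock.conv i.2 hf hg fun x y h => hF.rel_iff.2 ⟨_, h⟩
    obtain ⟨h, hh⟩ := hF.exists_cc_of_isBlock hX hb
    refine ⟨h, ?_, TopRel.universalRep_eq_mul fun γ => congrFun hh γ⟩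
    change TopRel.IsBlock _ _ ⇑h
    rwa [hh]
  star_mem' := by
    rintro _ ⟨f, hf, rfl⟩
    have hb := TopRel.IsBlock.star hf hF.equivalence.symm
    obtain ⟨h, hh⟩ := hF.exists_cc_of_isBlock hX hb
    refine ⟨h, ?_, TopRel.universalRep_eq_star fun x y hxy hyx => congrFun hh _⟩
    change TopRel.IsBlock _ _ ⇑h
    rwa [hh]

lemma finiteDimensional_blockAlgebra
    (i : {p : ℕ × DiscreteQuotient X // p.2.IsAdapted (φ p.1)}) :
    FiniteDimensional ℂ (hF.blockAlgebra hX i) :=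
  inferInstanceAs (FiniteDimensional ℂ
    ((TopRel.blockSpace (generatedGroupoid Z) (φ i.1.1) i.1.2).map
      (TopRel.universalRep (generatedGroupoid Z))))

lemma directed_blockAlgebra : Directed (· ≤ ·) (hF.blockAlgebra hX) := by
  rintro ⟨⟨n, q⟩, hq⟩ ⟨⟨m, r⟩, hr⟩
  -- Each `ker (φ k)` is clopen, so for a fine enough partition the classes of the coordinates
  -- decide which arrows of the larger kernel lie in it.
  have key : ∀ k, ∃ q₀ : DiscreteQuotient X,
      ∀ a b : (generatedGroupoid Z).Arrow, φ (max n m) a.range = φ (max n m) a.source →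
        φ (max n m) b.range = φ (max n m) b.source → q₀.proj a.range = q₀.proj b.range →
        q₀.proj a.source = q₀.proj b.source →
        (φ k a.range = φ k a.source ↔ φ k b.range = φ k b.source) := fun k =>
    hF.exists_forall_of_nhds hX (max n m) fun γ => by
      by_cases hγ : φ k γ.range = φ k γ.source
      · exact ⟨_, (hF.isOpen_ker k).mem_nhds hγ, fun a ha b hb => iff_of_true ha hb⟩
      · exact ⟨_, (hF.isClosed_ker hX k).isOpen_compl.mem_nhds hγ,
          fun a ha b hb => iff_of_false ha hb⟩
  obtain ⟨q₁, h₁⟩ := key n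
  obtain ⟨q₂, h₂⟩ := key m
  obtain ⟨p, hp, hpa⟩ := hF.exists_isAdapted_le hX (max n m) ((q ⊓ q₁) ⊓ (r ⊓ q₂))
  have mono : ∀ {k} {s q₀ : DiscreteQuotient X}, k ≤ max n m → p ≤ s ⊓ q₀ →
      (∀ a b : (generatedGroupoid Z).Arrow, φ (max n m) a.range = φ (max n m) a.source →
        φ (max n m) b.range = φ (max n m) b.source → q₀.proj a.range = q₀.proj b.range →
        q₀.proj a.source = q₀.proj b.source →
        (φ k a.range = φ k a.source ↔ φ k b.range = φ k b.source)) →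
      ∀ f : (generatedGroupoid Z).Arrow → ℂ, TopRel.IsBlock (φ k) s f →
        TopRel.IsBlock (φ (max n m)) p f := by
    intro k s q₀ hk hps h f hf
    refine ⟨fun γ hγ => hf.eq_zero γ fun h => hγ (hF.mono hk h), fun a b ha hb h1 h2 => ?_⟩
    have hs := hps.trans inf_le_left
    have h0 := hps.trans inf_le_right
    have hab := h a b ha hb (DiscreteQuotient.proj_eq_of_le h0 h1)
      (DiscreteQuotient.proj_eq_of_le h0 h2)
    by_cases hka : φ k a.range = φ k a.source
    · exact hf.eq_of_proj_eq a b hka (hab.1 hka) (DiscreteQuotient.proj_eq_of_le hs h1)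
        (DiscreteQuotient.proj_eq_of_le hs h2)
    · rw [hf.eq_zero a hka, hf.eq_zero b fun hb => hka (hab.2 hb)]
  refine ⟨⟨⟨max n m, p⟩, hpa⟩, ?_, ?_⟩
  · rintro _ ⟨f, hf, rfl⟩
    exact ⟨f, mono (le_max_left _ _) (hp.trans inf_le_left) h₁ f hf, rfl⟩
  · rintro _ ⟨f, hf, rfl⟩
    exact ⟨f, mono (le_max_right _ _) (hp.trans inf_le_right) h₂ f hf, rfl⟩

lemma exists_norm_sub_le (f : C_c((generatedGroupoid Z).Arrow, ℂ)) {ε : ℝ} (hε : 0 < ε) :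
    ∃ i, ∃ a ∈ hF.blockAlgebra hX i, ‖TopRel.universalRep _ f - a‖ ≤ ε := by
  obtain ⟨n, hn⟩ := f.hasCompactSupport.isCompact.elim_directed_cover
    (fun n => {γ : (generatedGroupoid Z).Arrow | φ n γ.range = φ n γ.source}) hF.isOpen_ker
    (fun γ _ => by
      obtain ⟨n, hn⟩ := hF.rel_iff.1 γ.2
      exact mem_iUnion.2 ⟨n, hn⟩)
    (directed_of_isDirected_le fun i j hij γ h => hF.mono hij h)
  have hfn : ∀ γ : (generatedGroupoid Z).Arrow, φ n γ.range ≠ φ n γ.source → f γ = 0 :=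
    fun γ hγ => image_eq_zero_of_notMem_tsupport fun h => hγ (hn h)
  -- The partition `r` serves only to bound the `I`-norm on `ker (φ n)`. Fixing it first lets the
  -- tolerance be chosen before the finer partition `q`. The `+ 1` below covers empty `X`.
  obtain ⟨r, -, hr⟩ := hF.exists_isAdapted_le hX n ⊤
  have hδ : 0 < ε / (Nat.card r + 1) := by positivity
  obtain ⟨q₀, hq₀⟩ := hF.exists_forall_of_nhds hX n
    (P := fun a b => ‖f a - f b‖ ≤ ε / (Nat.card r + 1)) fun γ => by
      refine ⟨_, f.continuous.continuousAt (Metric.ball_mem_nhds (f γ) (half_pos hδ)),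
        fun a ha b hb => ?_⟩
      rw [← dist_eq_norm]
      exact (dist_triangle_right _ _ (f γ)).trans
        (by linarith [show dist (f a) (f γ) < _ from ha, show dist (f b) (f γ) < _ from hb])
  obtain ⟨q, hq, hqa⟩ := hF.exists_isAdapted_le hX n q₀
  classical
  let g : (generatedGroupoid Z).Arrow → ℂ := fun γ =>
    if φ n γ.range = φ n γ.source then
      TopRel.coeff (φ n) q f (q.proj γ.range, q.proj γ.source) else 0
  have hg : TopRel.IsBlock (φ n) q g :=
    ⟨fun γ hγ => if_neg hγ, fun a b ha hb h1 h2 => by simp only [g, if_pos ha, if_pos hb, h1, h2]⟩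
  obtain ⟨g', hg'⟩ := hF.exists_cc_of_isBlock hX hg
  refine ⟨⟨⟨n, q⟩, hqa⟩, TopRel.universalRep _ g', ⟨g', ?_, rfl⟩, ?_⟩
  · change TopRel.IsBlock _ _ ⇑g'
    rwa [hg']
  rw [← map_sub]
  refine TopRel.norm_universalRep_le hε.le ((TopRel.iNorm_le_of_isAdapted hr hδ.le ?_ ?_).trans ?_)
  · intro γ hγ
    rw [CompactlySupportedContinuousMap.sub_apply, hg', hg.eq_zero γ hγ, hfn γ hγ, sub_zero]
  · intro γ
    rw [CompactlySupportedContinuousMap.sub_apply, hg']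
    by_cases hγ : φ n γ.range = φ n γ.source
    · obtain ⟨γ', h1, h2, h3, h4⟩ := TopRel.exists_coeff_eq (q := q) f hγ
      have : g γ = f γ' := (if_pos hγ).trans h4
      rw [this]
      exact hq₀ _ _ hγ h1 (DiscreteQuotient.proj_eq_of_le hq h2.symm)
        (DiscreteQuotient.proj_eq_of_le hq h3.symm)
    · rw [hg.eq_zero γ hγ, hfn γ hγ, sub_zero, norm_zero]
      exact hδ.le
  · rw [mul_div_assoc', div_le_iff₀ (by positivity)]
    nlinarith

lemma nonempty_index : Nonempty {p : ℕ × DiscreteQuotient X // p.2.IsAdapted (φ p.1)} := by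
  obtain ⟨q, -, hq⟩ := hF.exists_isAdapted_le hX 0 ⊤
  exact ⟨⟨⟨0, q⟩, hq⟩⟩

lemma cstar_le_closure :
    ((generatedGroupoid Z).cstar : Set (TopRel.RepProduct (generatedGroupoid Z))) ⊆
      closure (⋃ i, (hF.blockAlgebra hX i : Set (TopRel.RepProduct (generatedGroupoid Z)))) := by
  have := hF.nonempty_index hX
  have hdir := hF.directed_blockAlgebra hX
  rw [← NonUnitalStarSubalgebra.coe_iSup_of_directed hdir]
  change (generatedGroupoid Z).cstar ≤ (iSup (hF.blockAlgebra hX)).topologicalClosure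
  refine NonUnitalStarSubalgebra.topologicalClosure_minimal _ (NonUnitalStarAlgebra.adjoin_le ?_)
    (NonUnitalStarSubalgebra.isClosed_topologicalClosure _)
  rintro _ ⟨f, rfl⟩
  change _ ∈ closure (SetLike.coe (iSup (hF.blockAlgebra hX)))
  rw [NonUnitalStarSubalgebra.coe_iSup_of_directed hdir, Metric.mem_closure_iff]
  intro ε hε
  obtain ⟨i, a, ha, hfa⟩ := hF.exists_norm_sub_le hX f (half_pos hε)
  refine ⟨a, mem_iUnion.2 ⟨i, ha⟩, ?_⟩
  rw [dist_eq_norm]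
  linarith

lemma blockAlgebra_le_cstar (i : {p : ℕ × DiscreteQuotient X // p.2.IsAdapted (φ p.1)}) :
    hF.blockAlgebra hX i ≤ (generatedGroupoid Z).cstar := by
  rintro _ ⟨f, -, rfl⟩
  exact TopRel.universalRep_mem_cstar f

theorem isDirectedAFAlgebra : IsDirectedAFAlgebra (generatedGroupoid Z).cstar := by
  have := hF.nonempty_index hX
  have := hF.finiteDimensional_blockAlgebra hX
  refine isDirectedAFAlgebra_of_directed
    (NonUnitalStarSubalgebraClass.subtype (generatedGroupoid Z).cstar) isometry_subtype_coe
    (hF.directed_blockAlgebra hX) ?_ ?_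
  · exact fun i a ha => ⟨⟨a, hF.blockAlgebra_le_cstar hX i ha⟩, rfl⟩
  · exact fun a => hF.cstar_le_closure hX a.2

theorem isAF [SecondCountableTopology X] : (generatedGroupoid Z).IsAF := by
  have : TotallySeparatedSpace X := totallySeparatedSpace_of_t0_of_basis_clopen hX
  have : Countable (TopologicalSpace.Clopens X) :=
    TopologicalSpace.Clopens.countable_iff_secondCountable.2 inferInstance
  -- A partition is determined by the finite set of its clopen classes.
  have : Countable (DiscreteQuotient X) := (DiscreteQuotient.finsetClopens_inj X).countable
  have := hF.nonempty_index hX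
  have := hF.finiteDimensional_blockAlgebra hX
  refine isAFAlgebra_of_directed
    (NonUnitalStarSubalgebraClass.subtype (generatedGroupoid Z).cstar) isometry_subtype_coe
    (hF.directed_blockAlgebra hX) ?_ ?_
  · exact fun i a ha => ⟨⟨a, hF.blockAlgebra_le_cstar hX i ha⟩, rfl⟩
  · exact fun a => hF.cstar_le_closure hX a.2

end AFFiltration

/-! ### The return maps of a system of partial homeomorphisms -/

namespace PartialSystem

variable {X : Type u} [TopologicalSpace X] (D : PartialSystem X)

/-- The inverse of `σ_{r,s}^{(n+1)}` on the image of each of these maps. -/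
def back (n : ℕ) (x : X) : X :=
  open Classical in if h : ∃ p, x ∈ D.image (n + 1) p then
    (D.σ (n + 1) h.choose.1 h.choose.2).symm x else x

/-- The map which sends `x` to the point of `U_n` in its orbit under the maps of level at most
`n`. -/
def toBase : ℕ → X → X
  | 0 => id
  | n + 1 => D.back n ∘ toBase n

variable {D} (hD : D.Conditions)

lemma image_eq_target (n : ℕ) (p) : D.image n p = (D.σ n p.1 p.2).target := by
  rw [image, ← D.source_σ n p.1 p.2, OpenPartialHomeomorph.image_source_eq_target]

lemma mem_maps (n : ℕ) (r) (s) : D.σ n r s ∈ inverseSemigroup D.maps := by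
  refine .of ⟨D.σ n r s, ⟨n, r, s, rfl⟩, D.B n r, D.isClopen_B n r, (D.source_σ n r s).ge, ?_⟩
  refine ⟨?_, fun _ _ => rfl⟩
  rw [OpenPartialHomeomorph.restrOpen_source, D.source_σ, inter_self]

include hD

lemma back_apply {n : ℕ} {p} {x : X} (hx : x ∈ D.image (n + 1) p) :
    D.back n x = (D.σ (n + 1) p.1 p.2).symm x := by
  have h : ∃ p, x ∈ D.image (n + 1) p := ⟨p, hx⟩
  have hp : h.choose = p := by
    by_contra hne
    exact Set.disjoint_left.1 (hD.disjoint_image n hne) h.choose_spec hx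
  rw [back, dif_pos h, hp]

lemma back_σ {n : ℕ} {r} {s} {x : X} (hx : x ∈ D.B (n + 1) r) :
    D.back n (D.σ (n + 1) r s x) = x := by
  rw [back_apply hD (p := ⟨r, s⟩) ⟨x, hx, rfl⟩]
  exact (D.σ (n + 1) r s).left_inv (by rwa [D.source_σ])

lemma exists_mem_image {n : ℕ} {x : X} (hx : x ∈ D.U n) : ∃ p, x ∈ D.image (n + 1) p := by
  rwa [← hD.iUnion_image, mem_iUnion] at hx

lemma image_subset_U (n : ℕ) (p) : D.image (n + 1) p ⊆ D.U n := by
  rw [← hD.iUnion_image]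
  exact subset_iUnion _ p

lemma U_succ_subset (n : ℕ) : D.U (n + 1) ⊆ D.U n := by
  refine iUnion_subset fun r x hx => image_subset_U hD n ⟨r, ⟨0, D.κ_pos _ r⟩⟩ ⟨x, hx, ?_⟩
  exact hD.first_eq_id _ r x hx

/-- By (i), `x` is its own image under the first map on its `B(r, n + 1)`, so going back fixes it.
-/
lemma back_of_mem {n : ℕ} {x : X} (hx : x ∈ D.U (n + 1)) : D.back n x = x := by
  obtain ⟨r, hr⟩ := mem_iUnion.1 hx
  have h := back_σ hD (s := ⟨0, D.κ_pos _ r⟩) hr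
  rwa [hD.first_eq_id _ r x hr] at h

lemma toBase_of_mem {n : ℕ} {x : X} (hx : x ∈ D.U n) : D.toBase n x = x := by
  induction n with
  | zero => rfl
  | succ n ih => rw [toBase, Function.comp_apply, ih (U_succ_subset hD n hx), back_of_mem hD hx]

/-- At a positive level the image lies in the previous `U`, so the earlier steps fix it and the last
step undoes `σ`. -/
lemma toBase_σ {n : ℕ} {r} {s} {x : X} (hx : x ∈ D.B n r) :
    D.toBase n (D.σ n r s x) = D.toBase n x := by
  cases n with
  | zero =>
    have hs : s = ⟨0, D.κ_pos 0 r⟩ := Fin.ext (by have := s.2; have := D.κ_zero r; omega)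
    rw [hs, hD.first_eq_id 0 r x hx]
  | succ n =>
    have hU : D.σ (n + 1) r s x ∈ D.U n := image_subset_U hD n ⟨r, s⟩ ⟨x, hx, rfl⟩
    rw [toBase_of_mem hD (mem_iUnion.2 ⟨r, hx⟩), toBase, Function.comp_apply,
      toBase_of_mem hD hU, back_σ hD hx]

/-- Both claims go through one induction: membership in `U_n` supplies the map to invert next, so
the default value of `back` is never used along `toBase`. -/
lemma toBase_mem_and_exists_eqOn (n : ℕ) (x : X) : D.toBase n x ∈ D.U n ∧
    ∃ ρ ∈ inverseSemigroup D.maps, x ∈ ρ.source ∧ EqOn ρ (D.toBase n) ρ.source := by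
  induction n with
  | zero =>
    have r : Fin (D.m 0) := ⟨0, D.m_pos 0⟩
    refine ⟨mem_iUnion.2 ⟨r, by rw [D.B_zero]; trivial⟩, D.σ 0 r ⟨0, D.κ_pos 0 r⟩,
      mem_maps _ _ _, by rw [D.source_σ, D.B_zero]; trivial, fun y _ => ?_⟩
    exact hD.first_eq_id 0 r y (by rw [D.B_zero]; trivial)
  | succ n ih =>
    obtain ⟨hU, ρ, hρ, hx, heq⟩ := ih
    obtain ⟨p, hp⟩ := exists_mem_image hD hU
    have hback : ∀ y, D.toBase n y ∈ D.image (n + 1) p →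
        D.toBase (n + 1) y = (D.σ (n + 1) p.1 p.2).symm (D.toBase n y) :=
      fun y hy => back_apply hD hy
    refine ⟨?_, ρ.trans (D.σ (n + 1) p.1 p.2).symm, .comp hρ (.symm (mem_maps _ _ _)), ?_, ?_⟩
    · rw [hback x hp]
      refine mem_iUnion.2 ⟨p.1, ?_⟩
      rw [← D.source_σ _ p.1 p.2]
      exact (D.σ (n + 1) p.1 p.2).map_target (image_eq_target (n + 1) p ▸ hp)
    · rw [image_eq_target, ← heq hx] at hp
      simpa using ⟨hx, hp⟩
    · intro y hy
      simp only [OpenPartialHomeomorph.trans_source, OpenPartialHomeomorph.symm_source,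
        mem_inter_iff, mem_preimage] at hy
      have h2 := hy.2
      rw [heq hy.1, ← image_eq_target (n + 1) p] at h2
      rw [hback y h2, OpenPartialHomeomorph.coe_trans, Function.comp_apply, heq hy.1]

omit hD in
lemma toBase_mono {m n : ℕ} (hmn : m ≤ n) {x y : X} (h : D.toBase m x = D.toBase m y) :
    D.toBase n x = D.toBase n y := by
  induction n, hmn using Nat.le_induction with
  | base => exact h
  | succ k _ ih => exact congrArg (D.back k) ih

/-- A generator preserves the fibres at its own level; for a composition, the larger of the two
levels works. -/
lemma exists_toBase_comp_eq {ρ : OpenPartialHomeomorph X X} (hρ : InInverseSemigroup D.maps ρ) :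
    ∃ n, ∀ x ∈ ρ.source, D.toBase n (ρ x) = D.toBase n x := by
  induction hρ with
  | of h =>
    obtain ⟨_, ⟨n, r, s, rfl⟩, B, hB, hBs, heq⟩ := h
    refine ⟨n, fun x hx => ?_⟩
    rw [heq.eqOn hx]
    have h1 := heq.source_eq ▸ hx
    refine toBase_σ hD ?_
    rw [← D.source_σ n r s]
    exact h1.1
  | symm _ ih =>
    obtain ⟨n, hn⟩ := ih
    refine ⟨n, fun x hx => ?_⟩
    rename_i ρ _
    have := hn _ (ρ.map_target hx)
    rw [ρ.right_inv hx] at this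
    exact this.symm
  | comp _ _ ih ih' =>
    obtain ⟨n, hn⟩ := ih
    obtain ⟨m, hm⟩ := ih'
    refine ⟨max n m, fun x hx => ?_⟩
    rw [OpenPartialHomeomorph.trans_source] at hx
    exact (toBase_mono (le_max_right n m) (hm _ hx.2)).trans
      (toBase_mono (le_max_left n m) (hn _ hx.1))
  | congr _ heq ih =>
    obtain ⟨n, hn⟩ := ih
    refine ⟨n, fun x hx => ?_⟩
    have hx' := heq.source_eq ▸ hx
    rw [← heq.eqOn hx']
    exact hn x hx'

lemma afFiltration : AFFiltration (inverseSemigroup D.maps) D.toBase where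
  symm_mem _ h := .symm h
  trans_mem _ h _ h' := .comp h h'
  exists_comp_eq _ h := exists_toBase_comp_eq hD h
  exists_eqOn n x := (toBase_mem_and_exists_eqOn hD n x).2
  zero _ := rfl
  succ n _ _ h := congrArg (D.back n) h

end PartialSystem

end

theorem theorem2 {X : Type u} [TopologicalSpace X] [CompactSpace X] [T2Space X]
    (hX : TopologicalSpace.IsTopologicalBasis {V : Set X | IsClopen V})
    (D : PartialSystem X) (hD : D.Conditions) :
    D.groupoid.IsRDiscrete ∧
    IsDirectedAFAlgebra D.groupoid.cstar ∧
    (SecondCountableTopology X → D.groupoid.IsAF) := by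
  have hF := PartialSystem.afFiltration hD
  exact ⟨hF.isRDiscrete hX, hF.isDirectedAFAlgebra hX, fun _ => hF.isAF hX⟩
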